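/- A CP contraction between C*-algebras (with or without unit) is a completely positive linear map of operator norm at most $1$. A linear map $\alpha: S\to T$ between linear subspaces $S\subseteq A$, $T\subseteq B$ of C*-algebras is completely isometric if, for every $n$, the map $(x_{ij})\mapsto(\alpha(x_{ij}))$ preserves norms of $n\times n$ matrices with entries in $S$, the norms being those of the C*-algebras $M_n(A)$ and $M_n(B)$. Proposition 3.2. For every CP contraction $P: A\to A$ on a C*-algebra $A$, the following are equivalent. (i) $P$ admits a factorization $P=\alpha\circ E$, where $E: A\to A$ is an idempotent CP contraction and $\alpha$ is a completely isometric linear map of $E(A)$ onto itself. (ii) There are a C*-algebra $B$, a $*$-automorphism $\beta$ of $B$, and CP contractions $\theta: A\to B$ and $\theta_*: B\to A$ such that $\theta\circ\theta_*=\mathrm{id}_B$ and $P=\theta_*\circ\beta\circ\theta$. If $A$ has a unit $\mathbf 1$ and $P(\mathbf 1)=\mathbf 1$, then (i) can be replaced with (i)$'$ the restriction of $P$ to $P(A)$ is a completely isometric map of $P(A)$ onto itself; that is, in this case (i)$'$ is equivalent to (ii), and hence also to (i). -/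

import Mathlib

open scoped CStarAlgebra

section CPDefs

universe u v

/-- A linear map `f : S → T` between linear subspaces of C⋆-algebras `A` and `B` is completely
isometric: for every `n`, applying `f` to the entries of an `n × n` matrix with entries in `S`
preserves its norm, where matrices over `A` and over `B` carry their C⋆-norms. -/
def IsCompletelyIsometric {A : Type u} {B : Type v}
    [NonUnitalCStarAlgebra A] [PartialOrder A] [StarOrderedRing A]
    [NonUnitalCStarAlgebra B] [PartialOrder B] [StarOrderedRing B]
    {S : Submodule ℂ A} {T : Submodule ℂ B} (f : S →ₗ[ℂ] T) : Prop :=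
  ∀ (n : ℕ) (x : Fin n → Fin n → S),
    ‖(CStarMatrix.ofMatrix fun i j => (f (x i j) : B) : CStarMatrix (Fin n) (Fin n) B)‖ =
      ‖(CStarMatrix.ofMatrix fun i j => (x i j : A) : CStarMatrix (Fin n) (Fin n) A)‖

/-- A completely positive map of operator norm at most one. -/
def CompletelyPositiveMap.IsContraction {A : Type u} {B : Type v}
    [NonUnitalCStarAlgebra A] [PartialOrder A] [StarOrderedRing A]
    [NonUnitalCStarAlgebra B] [PartialOrder B] [StarOrderedRing B] (P : A →CP B) : Prop :=
  ∀ a : A, ‖P a‖ ≤ ‖a‖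

/-- The range of a completely positive map, as a linear subspace. -/
def CompletelyPositiveMap.range {A : Type u} {B : Type v}
    [NonUnitalCStarAlgebra A] [PartialOrder A] [StarOrderedRing A]
    [NonUnitalCStarAlgebra B] [PartialOrder B] [StarOrderedRing B] (P : A →CP B) :
    Submodule ℂ B :=
  LinearMap.range P.toLinearMap

/-- `P = α ∘ E` with `E : A → A` an idempotent completely positive contraction and `α` a
completely isometric linear map of `E(A)` onto itself. -/
def HasPolarFactorization {A : Type u}
    [NonUnitalCStarAlgebra A] [PartialOrder A] [StarOrderedRing A] (P : A →CP A) : Prop :=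
  ∃ (E : A →CP A) (α : E.range →ₗ[ℂ] E.range),
    E.IsContraction ∧ (∀ a : A, E (E a) = E a) ∧
    IsCompletelyIsometric α ∧ Function.Surjective α ∧
    ∀ a : A, P a = α ⟨E a, LinearMap.mem_range_self E.toLinearMap a⟩

/-- There are a C⋆-dynamical system `(B, β)` and completely positive contractions `θ : A → B`,
`θ' : B → A` with `θ ∘ θ' = id` and `P = θ' ∘ β ∘ θ`. Since such a `B` is a surjective image of
`A`, nothing is lost by taking it in the universe of `A`. -/
def ArisesFromDynamicalSystem {A : Type u}
    [NonUnitalCStarAlgebra A] [PartialOrder A] [StarOrderedRing A] (P : A →CP A) : Prop :=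
  ∃ (B : Type u) (_ : NonUnitalCStarAlgebra B) (_ : PartialOrder B) (_ : StarOrderedRing B)
    (β : B ≃⋆ₐ[ℂ] B) (θ : A →CP B) (θ' : B →CP A),
    θ.IsContraction ∧ θ'.IsContraction ∧ (∀ b : B, θ (θ' b) = b) ∧
    ∀ a : A, P a = θ' (β (θ a))

/-- The restriction of `P : A → A` to its range, as a linear map `P(A) → P(A)`. -/
def CompletelyPositiveMap.restrictRange {A : Type u}
    [NonUnitalCStarAlgebra A] [PartialOrder A] [StarOrderedRing A] (P : A →CP A) :
    P.range →ₗ[ℂ] P.range :=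
  P.toLinearMap.rangeRestrict ∘ₗ P.range.subtype

end CPDefs

/-! From a dynamical system to a factorization: completely positive contractions are completely
contractive, so θ', having the left inverse θ, is a complete isometry. Then E = θ'θ is an idempotent
with range θ'(B), and P acts on that range as β transported to A. The same computation on P(A) gives
the restriction statement.

From a factorization to a dynamical system: B is E(A) with the Choi–Effros product E(xy). The
Schwarz inequality supplies the identities E(Ex·Ea) = E(Ex·a) and E(Ea·Ex) = E(a·Ex), hence
associativity, and also the C⋆-identity. Matrix norms over B are those inherited from A, so α is a
complete isometry of B. An isometric positive map reflects positivity
(`PositiveLinearMap.nonneg_of_map_nonneg`), so α and its inverse are both completely positive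
contractions; their two Schwarz inequalities force equality, which makes α a ⋆-automorphism
(`IsCompleteIsometry.exists_starAlgEquiv`).

In the unital case the idempotent is E = (P restricted to P(A))⁻¹ ∘ P. It is completely positive
because positivity of a self-adjoint matrix can be read off from its distance to scalars, and P
preserves these distances on matrices over P(A), which contains the unit. -/

section OrderLemmas

/-! ### Order and positivity in C⋆-algebras -/

variable {C D : Type*} [NonUnitalCStarAlgebra C] [PartialOrder C] [StarOrderedRing C]
  [NonUnitalCStarAlgebra D] [PartialOrder D] [StarOrderedRing D]

/-- An isometric positive linear map between C⋆-algebras reflects positivity. -/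
theorem PositiveLinearMap.nonneg_of_map_nonneg (φ : C →ₚ[ℂ] D) (hφ : ∀ a, ‖φ a‖ = ‖a‖) {a : C}
    (h : 0 ≤ φ a) : 0 ≤ a := by
  have hinj : Function.Injective φ := by
    refine (injective_iff_map_eq_zero φ).2 fun x hx => ?_
    rw [← norm_eq_zero, ← hφ, hx, norm_zero]
  have ha : IsSelfAdjoint a := hinj (by rw [map_star, (IsSelfAdjoint.of_nonneg h).star_eq])
  by_contra hcon
  have hq : a⁻ ≠ 0 := fun h0 => hcon ((CFC.negPart_eq_zero_iff a ha).1 h0)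
  have hle : φ a⁻ ≤ φ a⁺ := by
    rw [← sub_nonneg, ← map_sub, CFC.posPart_sub_negPart a ha]; exact h
  have hq0 : 0 < ‖a⁻‖ := norm_pos_iff.2 hq
  have hφn : 0 ≤ φ a⁻ := φ.map_nonneg (CFC.negPart_nonneg a)
  -- This t gives the orthogonal elements a⁺ and t a⁻ equal norm, so their sum has norm ‖a⁺‖; its
  -- image dominates (1 + t) φ(a⁻), of norm ‖a⁻‖ + ‖a⁺‖, a contradiction.
  set t : ℝ := ‖a⁺‖ / ‖a⁻‖ with ht
  have ht0 : 0 ≤ t := by positivity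
  have hmax : ‖a⁺ + t • a⁻‖ = ‖a⁺‖ := by
    rw [IsSelfAdjoint.norm_add_eq_max]
    · rw [norm_smul, Real.norm_of_nonneg ht0, ht, div_mul_cancel₀ _ hq0.ne', max_self]
    · exact .of_nonneg (CFC.posPart_nonneg a)
    · exact .smul (.all t) (.of_nonneg (CFC.negPart_nonneg a))
    · rw [mul_smul_comm, CFC.posPart_mul_negPart, smul_zero]
  have hge : (1 + t) • φ a⁻ ≤ φ (a⁺ + t • a⁻) := by
    rw [map_add, add_smul, one_smul, φ.map_smul_of_tower]
    gcongr
  have := CStarAlgebra.norm_le_norm_of_nonneg_of_le (smul_nonneg (by positivity) hφn) hge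
  rw [hφ, hmax, norm_smul, hφ, Real.norm_of_nonneg (by positivity), add_mul, one_mul, ht,
    div_mul_cancel₀ _ hq0.ne'] at this
  linarith

theorem CStarAlgebra.exists_eq_star_mul_self_of_nonneg {a : C} (ha : 0 ≤ a) :
    ∃ b, a = star b * b :=
  CStarAlgebra.nonneg_iff_eq_star_mul_self.1 ha

/-- Conjugation by an approximate unit converges to the identity. -/
theorem CStarAlgebra.tendsto_conjugate_approximateUnit (c : C) :
    Filter.Tendsto (fun y => star y * c * y) (approximateUnit C) (nhds c) := by
  have hC := increasingApproximateUnit C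
  rw [tendsto_iff_norm_sub_tendsto_zero]
  have h1 := tendsto_iff_norm_sub_tendsto_zero.1 (hC.tendsto_mul_left c)
  have h2 := tendsto_iff_norm_sub_tendsto_zero.1 (hC.tendsto_mul_right c)
  have h3 := h1.add h2
  rw [add_zero] at h3
  refine squeeze_zero' (.of_forall fun _ => norm_nonneg _) ?_ h3
  filter_upwards [hC.eventually_norm, hC.eventually_star_eq] with y hy hy'
  rw [hy']
  calc ‖y * c * y - c‖ = ‖y * (c * y - c) + (y * c - c)‖ := by
        congr 1; rw [mul_sub, mul_assoc]; abel
    _ ≤ ‖y * (c * y - c)‖ + ‖y * c - c‖ := norm_add_le _ _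
    _ ≤ 1 * ‖c * y - c‖ + ‖y * c - c‖ := by
        gcongr
        exact (norm_mul_le _ _).trans (by gcongr)
    _ = _ := by rw [one_mul]

/-- In a C⋆-algebra, a linear perturbation that stays below every small quadratic one vanishes. -/
theorem eq_zero_of_forall_nonneg_smul_add {G H : C} (h : ∀ s : ℝ, 0 ≤ s • G + (s * s) • H) :
    G = 0 := by
  have key : ∀ G' : C, (∀ s : ℝ, 0 < s → 0 ≤ s • G' + (s * s) • H) → 0 ≤ G' := by
    intro G' h'
    have hlim : Filter.Tendsto (fun s : ℝ => G' + s • H) (nhdsWithin 0 (Set.Ioi 0)) (nhds G') := by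
      have : ContinuousAt (fun s : ℝ => G' + s • H) 0 := by fun_prop
      have h2 := this.tendsto
      simp only [zero_smul, add_zero] at h2
      exact h2.mono_left nhdsWithin_le_nhds
    refine CStarAlgebra.isClosed_nonneg.mem_of_tendsto hlim ?_
    filter_upwards [self_mem_nhdsWithin] with s hs
    have hs : 0 < s := hs
    have := smul_nonneg (inv_nonneg.2 hs.le) (h' s hs)
    rwa [smul_add, smul_smul, smul_smul, inv_mul_cancel₀ hs.ne', one_smul,
      inv_mul_cancel_left₀ hs.ne'] at this
  have h1 := key G fun s _ => h s
  have h2 := key (-G) fun s _ => by simpa using h (-s)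
  exact le_antisymm (neg_nonneg.1 h2) h1

/-- A degenerate vector of a positive C⋆-algebra-valued sesquilinear form is in its kernel. -/
theorem LinearMap.sesq_eq_zero_of_self_eq_zero {M : Type*} [AddCommGroup M] [Module ℂ M]
    (F : M →ₗ⋆[ℂ] M →ₗ[ℂ] C) (hF : ∀ a, 0 ≤ F a a) {y : M} (hy : F y y = 0) (a : M) :
    F y a = 0 := by
  have hsmul : ∀ (z : ℂ) (b c : M), F (z • b) c = starRingEnd ℂ z • F b c := fun z b c => by
    rw [map_smulₛₗ, LinearMap.smul_apply]
  have key : ∀ c : M, F y c + F c y = 0 := by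
    intro c
    refine eq_zero_of_forall_nonneg_smul_add (H := F c c) fun s =>
      (hF (y + (s : ℂ) • c)).trans_eq ?_
    rw [← Complex.coe_smul, ← Complex.coe_smul, Complex.ofReal_mul, mul_smul]
    simp only [map_add, LinearMap.add_apply, hsmul, map_smul, Complex.conj_ofReal, hy, smul_add,
      zero_add]
    abel
  have h1 := key a
  -- Replacing a by i·a turns the vanishing sum into a vanishing difference, which separates the two
  -- terms.
  have h2 : F y (Complex.I • a) + F (Complex.I • a) y = Complex.I • (F y a - F a y) := by
    rw [hsmul, map_smul, Complex.conj_I, neg_smul, ← sub_eq_add_neg, smul_sub]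
  have h3 : F y a - F a y = 0 :=
    (smul_eq_zero.1 (h2.symm.trans (key _))).resolve_left Complex.I_ne_zero
  have h4 : (2 : ℂ) • F y a = 0 := by
    rw [two_smul, ← add_zero (0 : C)]
    nth_rewrite 1 [← h1]
    rw [← h3]
    abel
  exact (smul_eq_zero.1 h4).resolve_left two_ne_zero

end OrderLemmas

/-! ### Positive matrices and block matrices -/

namespace CStarMatrix

variable {A : Type*} [NonUnitalCStarAlgebra A] [PartialOrder A] [StarOrderedRing A]
  {m n : Type*} [Fintype m] [Fintype n]

theorem diag_apply_nonneg {M : CStarMatrix n n A} (hM : 0 ≤ M) (i : n) : 0 ≤ M i i := by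
  obtain ⟨N, rfl⟩ := CStarAlgebra.exists_eq_star_mul_self_of_nonneg hM
  rw [mul_apply]
  exact Finset.sum_nonneg fun j _ => by rw [star_apply]; exact star_mul_self_nonneg _

/-- Compression of a positive `2 × 2` matrix by a column. -/
theorem compression_nonneg {M : CStarMatrix (Fin 2) (Fin 2) A} (hM : 0 ≤ M) (x y : A) :
    0 ≤ star x * M 0 0 * x + star x * M 0 1 * y + star y * M 1 0 * x + star y * M 1 1 * y := by
  have h := diag_apply_nonneg (star_left_conjugate_nonneg hM
    (ofMatrix !![x, 0; y, 0] : CStarMatrix (Fin 2) (Fin 2) A)) 0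
  refine h.trans_eq ?_
  simp only [mul_apply, star_apply, Fin.sum_univ_two, ofMatrix_apply]
  simp [add_mul]
  abel

/-- The block matrix with entries `u* u, u* a, a* u, a* a` is positive. -/
theorem gram_nonneg (u a : A) :
    0 ≤ (ofMatrix !![star u * u, star u * a; star a * u, star a * a] :
      CStarMatrix (Fin 2) (Fin 2) A) := by
  convert star_mul_self_nonneg (ofMatrix !![u, a; 0, 0] : CStarMatrix (Fin 2) (Fin 2) A) using 1
  ext i j
  fin_cases i <;> fin_cases j <;> simp [mul_apply, star_apply]

variable (m n A) in
/-- Matrices of matrices are block matrices. -/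
def blockEquiv : CStarMatrix m m (CStarMatrix n n A) ≃⋆ₐ[ℂ] CStarMatrix (m × n) (m × n) A where
  toFun M := ofMatrix fun p q => M p.1 q.1 p.2 q.2
  invFun N := ofMatrix fun i j => ofMatrix fun k l => N (i, k) (j, l)
  left_inv _ := rfl
  right_inv _ := rfl
  map_mul' M N := by
    ext p q
    simp only [mul_apply, Fintype.sum_prod_type]
    exact Matrix.sum_apply p.2 q.2 Finset.univ fun j => M p.1 j * N j q.1
  map_add' _ _ := rfl
  map_star' _ := rfl
  map_smul' _ _ := rfl

/-- Scalar diagonal matrices, as a ⋆-homomorphism. -/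
def scalarHom [DecidableEq n] : A →⋆ₙₐ[ℂ] CStarMatrix n n A where
  toFun a := ofMatrix (Matrix.diagonal fun _ => a)
  map_smul' c a := by ext i j; by_cases h : i = j <;> simp [h]
  map_zero' := by ext i j; by_cases h : i = j <;> simp [h]
  map_add' a b := by ext i j; by_cases h : i = j <;> simp [h]
  map_mul' a b := by
    ext i j
    simp only [mul_apply, ofMatrix_apply]
    rw [← Matrix.mul_apply, Matrix.diagonal_mul_diagonal]
  map_star' a := by
    ext i j
    rw [star_apply]
    by_cases h : i = j
    · simp [h]
    · simp [h, Ne.symm h]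

theorem norm_scalarHom [DecidableEq n] [Nonempty n] (a : A) :
    ‖(scalarHom a : CStarMatrix n n A)‖ = ‖a‖ := by
  refine NonUnitalStarAlgHom.norm_map (scalarHom : A →⋆ₙₐ[ℂ] CStarMatrix n n A) (fun x y h => ?_) a
  obtain ⟨i⟩ := ‹Nonempty n›
  simpa [scalarHom] using ext_iff.2 h i i

end CStarMatrix

/-! ### Schwarz inequality and complete contractivity -/

namespace CompletelyPositiveMap

variable {A B C : Type*} [NonUnitalCStarAlgebra A] [PartialOrder A] [StarOrderedRing A]
  [NonUnitalCStarAlgebra B] [PartialOrder B] [StarOrderedRing B]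
  [NonUnitalCStarAlgebra C] [PartialOrder C] [StarOrderedRing C]

/-- The entrywise action of a completely positive map on matrices is completely positive. -/
def mapMatrix (n : Type*) [Fintype n] (φ : A →CP B) : CStarMatrix n n A →CP CStarMatrix n n B where
  toLinearMap := CStarMatrix.mapₗ φ.toLinearMap
  map_cstarMatrix_nonneg' k M hM := by
    have h1 : 0 ≤ CStarMatrix.blockEquiv A (Fin k) n M :=
      map_nonneg (CStarMatrix.blockEquiv A (Fin k) n) hM
    have h2 := φ.map_cstarMatrix_nonneg _ h1
    have h3 : 0 ≤ (CStarMatrix.blockEquiv B (Fin k) n).symm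
        ((CStarMatrix.blockEquiv A (Fin k) n M).map φ) :=
      map_nonneg (CStarMatrix.blockEquiv B (Fin k) n).symm h2
    refine h3.trans_eq ?_
    ext i j
    rfl

@[simp]
theorem mapMatrix_apply (n : Type*) [Fintype n] (φ : A →CP B) (M : CStarMatrix n n A) :
    φ.mapMatrix n M = M.map φ := rfl

theorem mapMatrix_scalarHom {n : Type*} [Fintype n] [DecidableEq n] (φ : A →CP B) (a : A) :
    φ.mapMatrix n (CStarMatrix.scalarHom a) = CStarMatrix.scalarHom (φ a) := by
  ext i j
  by_cases h : i = j <;> simp [CStarMatrix.scalarHom, h]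

/-- Composition of completely positive maps. -/
def comp (ψ : B →CP C) (φ : A →CP B) : A →CP C where
  toLinearMap := ψ.toLinearMap ∘ₗ φ.toLinearMap
  map_cstarMatrix_nonneg' _ M hM :=
    ψ.map_cstarMatrix_nonneg _ (φ.map_cstarMatrix_nonneg M hM)

/-- The Schwarz inequality, relative to an approximate unit whose squares are mapped
contractively. -/
theorem schwarz_of_tendsto (φ : A →CP B) {ι : Type*} {l : Filter ι} [l.NeBot] {u : ι → A}
    (hu : ∀ᶠ i in l, star (u i) = u i) (hlim : ∀ a, Filter.Tendsto (fun i => u i * a) l (nhds a))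
    (hφ : ∀ᶠ i in l, ‖φ (u i * u i)‖ ≤ 1) (a : A) : star (φ a) * φ a ≤ φ (star a * a) := by
  -- Compress the image of the Gram matrix of (u, a) by the column (-φ(ua), y). With a unit one
  -- would take y = 1; here y stays free so that it can later run along an approximate unit of B.
  have hfin : ∀ᶠ i in l, ∀ y : B, 0 ≤ star (φ (u i * a)) * φ (u i * a)
      - star (φ (u i * a)) * φ (u i * a) * y - star y * (star (φ (u i * a)) * φ (u i * a))
      + star y * φ (star a * a) * y := by
    filter_upwards [hu, hφ] with i hi hi' y
    set b := φ (u i * a) with hb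
    have h := CStarMatrix.compression_nonneg
      (φ.map_cstarMatrix_nonneg _ (CStarMatrix.gram_nonneg (u i) a)) (-b) y
    have hstar : φ (star a * u i) = star b := by
      rw [hb, ← map_star, star_mul, hi]
    simp only [CStarMatrix.map_apply, CStarMatrix.ofMatrix_apply, Matrix.of_apply,
      Matrix.cons_val_zero, Matrix.cons_val_one, Matrix.cons_val', Matrix.cons_val_fin_one,
      hi, star_neg, hstar, ← hb] at h
    have h2 : star b * φ (u i * u i) * b ≤ star b * b := by
      refine (CStarAlgebra.star_left_conjugate_le_norm_smul (a := b)
        (b := φ (u i * u i)) ?_).trans ?_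
      · rw [IsSelfAdjoint, ← map_star, star_mul, hi]
      · calc ‖φ (u i * u i)‖ • (star b * b) ≤ (1 : ℝ) • (star b * b) :=
              smul_le_smul_of_nonneg_right hi' (star_mul_self_nonneg b)
          _ = _ := one_smul _ _
    refine h.trans ?_
    rw [← sub_nonneg] at h2 ⊢
    refine h2.trans_eq ?_
    simp only [neg_mul, mul_neg, neg_neg, mul_assoc]
    abel
  have hlim1 : Filter.Tendsto (fun i => φ (u i * a)) l (nhds (φ a)) :=
    ((map_continuous φ).tendsto a).comp (hlim a)
  have hstep : ∀ y : B, 0 ≤ star (φ a) * φ a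
      - star (φ a) * φ a * y - star y * (star (φ a) * φ a) + star y * φ (star a * a) * y := by
    intro y
    refine CStarAlgebra.isClosed_nonneg.mem_of_tendsto (b := l) ?_ (hfin.mono fun i hi => hi y)
    have h1 := hlim1.star.mul hlim1
    exact ((h1.sub (h1.mul_const y)).sub (h1.const_mul (star y))).add_const _
  have hB := CStarAlgebra.increasingApproximateUnit B
  set z := star (φ a) * φ a with hz
  have hfinal : 0 ≤ z - z - z + φ (star a * a) := by
    refine CStarAlgebra.isClosed_nonneg.mem_of_tendsto (((tendsto_const_nhds.sub
      (hB.tendsto_mul_left z)).sub ?_).add (CStarAlgebra.tendsto_conjugate_approximateUnit _))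
      (.of_forall hstep)
    refine (hB.tendsto_mul_right z).congr' ?_
    filter_upwards [hB.eventually_star_eq] with y hy
    rw [hy]
  rw [← sub_nonneg]
  refine hfinal.trans_eq ?_
  abel

/-- A bounded linear map satisfying the Schwarz inequality is a contraction. -/
theorem norm_apply_le_of_schwarz (φ : A →CP B) (h : ∀ a, star (φ a) * φ a ≤ φ (star a * a))
    (a : A) : ‖φ a‖ ≤ ‖a‖ := by
  let f : A →L[ℂ] B := ⟨φ.toLinearMap, map_continuous φ⟩
  have hf : ∀ a, ‖f a‖ ≤ √‖f‖ * ‖a‖ := by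
    intro a
    have h1 : ‖f a‖ * ‖f a‖ ≤ ‖f‖ * (‖a‖ * ‖a‖) := by
      rw [← CStarRing.norm_star_mul_self, ← CStarRing.norm_star_mul_self]
      exact (CStarAlgebra.norm_le_norm_of_nonneg_of_le (star_mul_self_nonneg _) (h a)).trans
        (f.le_opNorm _)
    refine abs_le_of_sq_le_sq' ?_ (by positivity) |>.2
    rw [mul_pow, Real.sq_sqrt (norm_nonneg _), sq, sq]
    exact h1
  -- Bootstrapping: the Schwarz bound improves ‖f‖ to √‖f‖, and ‖f‖ ≤ √‖f‖ forces ‖f‖ ≤ 1.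
  have h1 : ‖f‖ ≤ √‖f‖ := f.opNorm_le_bound (by positivity) hf
  have h2 : √‖f‖ ≤ 1 := by
    by_contra hc
    push Not at hc
    nlinarith [Real.mul_self_sqrt (norm_nonneg f)]
  exact (hf a).trans (mul_le_of_le_one_left (norm_nonneg _) h2)

/-- Contractivity on matrices is not yet available, being a consequence of this inequality. It is
needed only on scalar diagonal matrices built from an approximate unit of A, where it reduces to
contractivity of φ. -/
theorem IsContraction.mapMatrix_schwarz {φ : A →CP B} (hφ : φ.IsContraction) (n : Type*)
    [Fintype n] (M : CStarMatrix n n A) :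
    star (φ.mapMatrix n M) * φ.mapMatrix n M ≤ φ.mapMatrix n (star M * M) := by
  classical
  have hA := CStarAlgebra.increasingApproximateUnit A
  refine schwarz_of_tendsto (φ.mapMatrix n) (l := CStarAlgebra.approximateUnit A)
    (u := fun a => CStarMatrix.scalarHom a) ?_ (fun N => ?_) ?_ M
  · filter_upwards [hA.eventually_star_eq] with a ha
    rw [← map_star, ha]
  · refine tendsto_pi_nhds.2 fun i => tendsto_pi_nhds.2 fun j => ?_
    refine (hA.tendsto_mul_right (N i j)).congr fun a => ?_
    simp [CStarMatrix.scalarHom, CStarMatrix.mul_apply, Matrix.diagonal_apply]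
  · filter_upwards [hA.eventually_norm] with a ha
    rw [← map_mul]
    rw [mapMatrix_scalarHom]
    refine (NonUnitalStarAlgHom.norm_apply_le _ _).trans ((hφ _).trans ?_)
    exact (norm_mul_le _ _).trans (mul_le_one₀ ha (norm_nonneg _) ha)

/-- The Schwarz inequality for completely positive contractions. -/
theorem IsContraction.schwarz {φ : A →CP B} (hφ : φ.IsContraction) (a : A) :
    star (φ a) * φ a ≤ φ (star a * a) := by
  have hA := CStarAlgebra.increasingApproximateUnit A
  refine schwarz_of_tendsto φ (u := id) hA.eventually_star_eq hA.tendsto_mul_right ?_ a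
  filter_upwards [hA.eventually_norm] with a ha
  exact (hφ _).trans ((norm_mul_le _ _).trans (mul_le_one₀ ha (norm_nonneg _) ha))

/-- Completely positive contractions are completely contractive. -/
theorem IsContraction.mapMatrix {φ : A →CP B} (hφ : φ.IsContraction) (n : Type*) [Fintype n] :
    (φ.mapMatrix n).IsContraction :=
  norm_apply_le_of_schwarz _ (hφ.mapMatrix_schwarz n)

/-- The sesquilinear defect in the Schwarz inequality. -/
def schwarzDefect (φ : A →CP B) : A →ₗ⋆[ℂ] A →ₗ[ℂ] B :=
  LinearMap.mk₂'ₛₗ (starRingEnd ℂ) (RingHom.id ℂ)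
    (fun a b => φ (star a * b) - star (φ a) * φ b)
    (fun a b c => by simp only [star_add, map_add, add_mul]; abel)
    (fun c a b => by simp [smul_sub, smul_mul_assoc])
    (fun a b c => by simp only [map_add, mul_add]; abel)
    (fun c a b => by simp [smul_sub, mul_smul_comm])

theorem IsContraction.schwarzDefect_nonneg {φ : A →CP B} (hφ : φ.IsContraction) (a : A) :
    0 ≤ φ.schwarzDefect a a := sub_nonneg.2 (hφ.schwarz a)

theorem IsContraction.comp {ψ : B →CP C} {φ : A →CP B} (hψ : ψ.IsContraction)
    (hφ : φ.IsContraction) : (ψ.comp φ).IsContraction :=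
  fun a => (hψ _).trans (hφ a)

/-- A completely positive map that is isometric on all matrix algebras. -/
def IsCompleteIsometry (φ : A →CP B) : Prop :=
  ∀ (n : ℕ) (M : CStarMatrix (Fin n) (Fin n) A), ‖φ.mapMatrix (Fin n) M‖ = ‖M‖

theorem IsCompleteIsometry.mapMatrix_nonneg_iff {φ : A →CP B} (hφ : φ.IsCompleteIsometry) {n : ℕ}
    {M : CStarMatrix (Fin n) (Fin n) A} : 0 ≤ φ.mapMatrix (Fin n) M ↔ 0 ≤ M :=
  ⟨(PositiveLinearMap.ofClass (φ.mapMatrix (Fin n))).nonneg_of_map_nonneg (hφ n),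
    map_nonneg (φ.mapMatrix (Fin n))⟩

theorem IsCompleteIsometry.norm_map {φ : A →CP B} (hφ : φ.IsCompleteIsometry) (a : A) :
    ‖φ a‖ = ‖a‖ := by
  have h := hφ 1 (CStarMatrix.scalarHom a)
  rwa [mapMatrix_scalarHom, CStarMatrix.norm_scalarHom, CStarMatrix.norm_scalarHom] at h

/-- A contraction with a completely positive contractive left inverse is a complete isometry. -/
theorem IsContraction.isCompleteIsometry {φ : A →CP B} (hφ : φ.IsContraction) {ψ : B →CP A}
    (hψ : ψ.IsContraction) (h : ∀ a, ψ (φ a) = a) : φ.IsCompleteIsometry := by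
  intro n M
  refine le_antisymm (hφ.mapMatrix (Fin n) M) ?_
  have h1 := hψ.mapMatrix (Fin n) (φ.mapMatrix (Fin n) M)
  have h2 : ψ.mapMatrix (Fin n) (φ.mapMatrix (Fin n) M) = M := by ext i j; simp [h]
  rwa [h2] at h1

end CompletelyPositiveMap

/-! ### The Choi–Effros algebra -/

namespace CompletelyPositiveMap

universe u

variable {A : Type u} [NonUnitalCStarAlgebra A] [PartialOrder A] [StarOrderedRing A]

/-- Idempotent completely positive contractions. -/
structure IsContractiveProjection (E : A →CP A) : Prop where
  contraction : E.IsContraction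
  idem : ∀ a, E (E a) = E a

namespace IsContractiveProjection

variable {E : A →CP A}

theorem mapMatrix (h : E.IsContractiveProjection) (n : Type*) [Fintype n] :
    (E.mapMatrix n).IsContractiveProjection where
  contraction := h.contraction.mapMatrix n
  idem M := by ext i j; simp [h.idem]

/-- E applied to its own Schwarz defect is a positive sesquilinear form, and fixed points of E are
degenerate for it; hence they lie in its kernel. -/
theorem apply_mul_apply_left (h : E.IsContractiveProjection) (x a : A) :
    E (E x * E a) = E (E x * a) := by
  have hF : ∀ a, 0 ≤ E.schwarzDefect.compr₂ₛₗ E.toLinearMap a a := fun a =>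
    map_nonneg E (h.contraction.schwarzDefect_nonneg a)
  have hFapp : ∀ a b, E.schwarzDefect.compr₂ₛₗ E.toLinearMap a b
      = E (star a * b) - E (star (E a) * E b) := fun a b =>
    (map_sub E _ _).trans (by rw [h.idem])
  have hy : E (star (E x)) = star (E x) := by rw [← map_star, h.idem]
  have h0 := LinearMap.sesq_eq_zero_of_self_eq_zero _ hF (y := star (E x))
    (by rw [hFapp, hy, sub_self]) a
  rw [hFapp, hy, star_star] at h0
  exact (sub_eq_zero.1 h0).symm

theorem apply_mul_apply_right (h : E.IsContractiveProjection) (a x : A) :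
    E (E a * E x) = E (a * E x) := by
  have := congrArg star (h.apply_mul_apply_left (star x) (star a))
  simpa only [← map_star, star_mul, star_star] using this

end IsContractiveProjection

/-- The Choi–Effros algebra of an idempotent completely positive contraction `E`: the range of `E`
with the norm and involution of `A` and the product `x * y = E (x y)`. -/
@[nolint unusedArguments]
def ChoiEffros (E : A →CP A) (_ : E.IsContractiveProjection) : Type u := E.range

namespace ChoiEffros

variable {E : A →CP A} {h : E.IsContractiveProjection}

noncomputable instance : NormedAddCommGroup (ChoiEffros E h) :=
  inferInstanceAs (NormedAddCommGroup E.range)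

noncomputable instance : NormedSpace ℂ (ChoiEffros E h) :=
  inferInstanceAs (NormedSpace ℂ E.range)

variable (E h) in
/-- The inclusion of the Choi–Effros algebra, as a linear map. -/
noncomputable def val : ChoiEffros E h →ₗ[ℂ] A := E.range.subtype

variable (E h) in
/-- The projection onto the Choi–Effros algebra, as a linear map. -/
noncomputable def proj : A →ₗ[ℂ] ChoiEffros E h := E.toLinearMap.rangeRestrict

@[simp] theorem val_proj (a : A) : val E h (proj E h a) = E a := rfl

theorem val_injective : Function.Injective (val E h) := Subtype.val_injective

theorem norm_val (x : ChoiEffros E h) : ‖val E h x‖ = ‖x‖ := rfl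

@[simp] theorem apply_val (x : ChoiEffros E h) : E (val E h x) = val E h x := by
  obtain ⟨_, a, rfl⟩ := x
  exact h.idem a

@[simp] theorem proj_val (x : ChoiEffros E h) : proj E h (val E h x) = x :=
  val_injective (by simp)

noncomputable instance : Mul (ChoiEffros E h) := ⟨fun x y => proj E h (val E h x * val E h y)⟩

noncomputable instance : Star (ChoiEffros E h) := ⟨fun x => proj E h (star (val E h x))⟩

@[simp] theorem val_mul (x y : ChoiEffros E h) :
    val E h (x * y) = E (val E h x * val E h y) := rfl

@[simp] theorem val_star (x : ChoiEffros E h) : val E h (star x) = star (val E h x) := by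
  change E (star (val E h x)) = _
  rw [map_star, apply_val]

theorem apply_mul_left (a : A) (x : ChoiEffros E h) : E (E a * val E h x) = E (a * val E h x) := by
  have := h.apply_mul_apply_right a (val E h x)
  rwa [apply_val] at this

theorem apply_mul_right (x : ChoiEffros E h) (a : A) : E (val E h x * E a) = E (val E h x * a) := by
  have := h.apply_mul_apply_left (val E h x) a
  rwa [apply_val] at this

noncomputable instance : NonUnitalNormedRing (ChoiEffros E h) where
  __ := (inferInstance : NormedAddCommGroup (ChoiEffros E h))
  left_distrib x y z := val_injective (by simp [mul_add])
  right_distrib x y z := val_injective (by simp [add_mul])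
  zero_mul x := val_injective (by simp)
  mul_zero x := val_injective (by simp)
  mul_assoc x y z := val_injective (by simp [apply_mul_left, apply_mul_right, mul_assoc])
  norm_mul_le x y := (h.contraction _).trans (norm_mul_le (val E h x) (val E h y))

noncomputable instance : StarRing (ChoiEffros E h) where
  star_involutive x := val_injective (by simp)
  star_mul x y := val_injective (by simp [← map_star])
  star_add x y := val_injective (by simp)

instance : CompleteSpace (ChoiEffros E h) := by
  have hclosed : IsClosed (E.range : Set A) := by
    have : (E.range : Set A) = {a | E a = a} := by
      ext a
      exact ⟨fun ⟨b, hb⟩ => by rw [← hb]; exact h.idem b, fun ha => ⟨a, ha⟩⟩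
    rw [this]
    exact isClosed_eq (map_continuous E) continuous_id
  exact hclosed.completeSpace_coe

instance : CStarRing (ChoiEffros E h) where
  norm_mul_self_le x := by
    -- For a fixed point x the Schwarz inequality reads x⋆x ≤ E(x⋆x), so the new product does not
    -- lower the norm of x⋆x.
    rw [← norm_val x, ← CStarRing.norm_star_mul_self, ← norm_val (star x * x), val_mul, val_star]
    have h1 := h.contraction.schwarz (val E h x)
    rw [apply_val] at h1
    exact CStarAlgebra.norm_le_norm_of_nonneg_of_le (star_mul_self_nonneg _) h1

noncomputable instance : NonUnitalCStarAlgebra (ChoiEffros E h) where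
  smul_assoc c x y := val_injective (by simp [smul_mul_assoc])
  smul_comm c x y := val_injective (by simp [mul_smul_comm])
  star_smul c x := val_injective (by simp)

/-- The order is intrinsic to the new product; its agreement with positivity in A follows because
the inclusion is completely positive and isometric. -/
noncomputable instance : PartialOrder (ChoiEffros E h) := CStarAlgebra.spectralOrder _

instance : StarOrderedRing (ChoiEffros E h) := CStarAlgebra.spectralOrderedRing _

/-- Matrices over the Choi–Effros algebra of `E` form the Choi–Effros algebra of the entrywise
extension of `E`. -/
noncomputable def matrixHom (n : Type*) [Fintype n] : CStarMatrix n n (ChoiEffros E h) →⋆ₙₐ[ℂ]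
    ChoiEffros (E.mapMatrix n) (h.mapMatrix n) where
  toFun M := ⟨M.map (val E h), M.map (val E h), by ext i j; exact apply_val _⟩
  map_smul' c M := val_injective (by ext i j; exact map_smul (val E h) c (M i j))
  map_zero' := val_injective (by ext i j; exact map_zero (val E h))
  map_add' M N := val_injective (by ext i j; exact map_add (val E h) (M i j) (N i j))
  map_mul' M N := val_injective (by
    ext i j
    change val E h (∑ k, M i k * N k j) = E (∑ k, val E h (M i k) * val E h (N k j))
    simp)
  map_star' M := val_injective (by
    refine Eq.trans ?_ (val_star _).symm
    ext i j
    exact val_star (M j i))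

/-- An injective ⋆-homomorphism of C⋆-algebras is isometric, and `matrixHom` lands in an algebra
normed by matrices over A. -/
theorem norm_map_val (n : Type*) [Fintype n] (M : CStarMatrix n n (ChoiEffros E h)) :
    ‖M.map (val E h)‖ = ‖M‖ :=
  NonUnitalStarAlgHom.norm_map (matrixHom n) (fun _ _ hMN =>
    CStarMatrix.map_injective val_injective (congrArg (val _ _) hMN)) M

variable (E h) in
/-- The inclusion of the Choi–Effros algebra is completely positive. -/
noncomputable def inclusion : ChoiEffros E h →CP A where
  toLinearMap := val E h
  map_cstarMatrix_nonneg' k M hM := by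
    obtain ⟨N, rfl⟩ := CStarAlgebra.exists_eq_star_mul_self_of_nonneg hM
    have h1 := map_nonneg (E.mapMatrix (Fin k)) (star_mul_self_nonneg (N.map (val E h)))
    refine h1.trans_eq ?_
    ext i j
    simp [CStarMatrix.mul_apply, CStarMatrix.star_apply]

theorem isCompleteIsometry_inclusion : (inclusion E h).IsCompleteIsometry :=
  fun n M => norm_map_val (Fin n) M

variable (E h) in
/-- The projection onto the Choi–Effros algebra is completely positive. -/
noncomputable def projection : A →CP ChoiEffros E h where
  toLinearMap := proj E h
  map_cstarMatrix_nonneg' _ M hM :=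
    -- Following the projection by the inclusion gives E, and the inclusion reflects positivity of
    -- matrices.
    isCompleteIsometry_inclusion.mapMatrix_nonneg_iff.1 (E.map_cstarMatrix_nonneg M hM)

theorem isContraction_inclusion : (inclusion E h).IsContraction := fun x => (norm_val x).le

theorem isContraction_projection : (projection E h).IsContraction := h.contraction

end ChoiEffros

/-- A surjective completely positive complete isometry between C⋆-algebras is a
⋆-isomorphism. -/
theorem IsCompleteIsometry.exists_starAlgEquiv {B C : Type*} [NonUnitalCStarAlgebra B]
    [PartialOrder B] [StarOrderedRing B] [NonUnitalCStarAlgebra C] [PartialOrder C]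
    [StarOrderedRing C] {φ : B →CP C} (hφ : φ.IsCompleteIsometry) (hsurj : Function.Surjective φ) :
    ∃ β : B ≃⋆ₐ[ℂ] C, ∀ b, β b = φ b := by
  have hinj : Function.Injective φ := (injective_iff_map_eq_zero φ).2 fun x hx => by
    rw [← norm_eq_zero, ← hφ.norm_map, hx, norm_zero]
  let e : B ≃ₗ[ℂ] C := LinearEquiv.ofBijective φ.toLinearMap ⟨hinj, hsurj⟩
  have he : ∀ c, φ (e.symm c) = c := e.apply_symm_apply
  have he' : ∀ b, e.symm (φ b) = b := e.symm_apply_apply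
  let ψ : C →CP B :=
    { toLinearMap := e.symm.toLinearMap
      map_cstarMatrix_nonneg' := fun k M hM => by
        rw [← hφ.mapMatrix_nonneg_iff]
        refine hM.trans_eq ?_
        ext i j
        exact (he (M i j)).symm }
  have hψ : ∀ c, ψ c = e.symm c := fun _ => rfl
  have hφc : φ.IsContraction := fun b => (hφ.norm_map b).le
  have hψc : ψ.IsContraction := fun c => by rw [← hφ.norm_map, hψ, he]
  -- Schwarz for φ gives one inequality; φ applied to Schwarz for ψ at φ(b) gives the other. So
  -- every b is degenerate for the Schwarz defect.
  have hsq : ∀ b, φ (star b * b) = star (φ b) * φ b := by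
    intro b
    refine le_antisymm ?_ (hφc.schwarz b)
    have h1 := OrderHomClass.mono φ (hψc.schwarz (φ b))
    simpa only [hψ, he, he'] using h1
  have hmul : ∀ a b, φ (star a * b) = star (φ a) * φ b := by
    intro a b
    exact sub_eq_zero.1 (LinearMap.sesq_eq_zero_of_self_eq_zero φ.schwarzDefect
      hφc.schwarzDefect_nonneg (sub_eq_zero.2 (hsq a)) b)
  let β : B ≃⋆ₐ[ℂ] C :=
    { toFun := φ
      invFun := e.symm
      left_inv := he'
      right_inv := he
      map_mul' := fun a b => by
        have := hmul (star a) b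
        rwa [star_star, map_star, star_star] at this
      map_add' := map_add φ
      map_star' := map_star φ
      map_smul' := map_smul φ }
  exact ⟨β, fun _ => rfl⟩

end CompletelyPositiveMap

/-! ### Factorizations and dynamical systems -/

namespace CompletelyPositiveMap

universe u v

variable {A : Type u} [NonUnitalCStarAlgebra A] [PartialOrder A] [StarOrderedRing A]
  {B : Type v} [NonUnitalCStarAlgebra B] [PartialOrder B] [StarOrderedRing B]

theorem mem_range_iff_of_idem {E : A →CP A} (hE : ∀ a, E (E a) = E a) {a : A} :
    a ∈ E.range ↔ E a = a :=
  ⟨fun ⟨b, hb⟩ => by rw [← hb]; exact hE b, fun h => ⟨a, h⟩⟩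

/-- A ⋆-isomorphism as a completely positive map. -/
def ofStarAlgEquiv (β : A ≃⋆ₐ[ℂ] B) : A →CP B where
  toLinearMap := (β : A →ₗ[ℂ] B)
  map_cstarMatrix_nonneg' _ _ hM :=
    map_nonneg (CStarMatrix.mapₙₐ (β : A →⋆ₙₐ[ℂ] B)) hM

theorem isContraction_ofStarAlgEquiv (β : A ≃⋆ₐ[ℂ] B) : (ofStarAlgEquiv β).IsContraction :=
  fun a => (StarAlgEquiv.norm_map β a).le

/-- Conjugating a ⋆-automorphism by a completely isometric inclusion is completely isometric on
the image of the inclusion. -/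
theorem norm_map_conjugate_starAlgEquiv {θ' : B →CP A} (hθ' : θ'.IsCompleteIsometry)
    (β : B ≃⋆ₐ[ℂ] B) {n : ℕ} (M : Fin n → Fin n → B) :
    ‖(CStarMatrix.ofMatrix fun i j => θ' (β (M i j)) : CStarMatrix (Fin n) (Fin n) A)‖
      = ‖(CStarMatrix.ofMatrix fun i j => θ' (M i j) : CStarMatrix (Fin n) (Fin n) A)‖ := by
  have hβ : (ofStarAlgEquiv β).IsCompleteIsometry :=
    (isContraction_ofStarAlgEquiv β).isCompleteIsometry (isContraction_ofStarAlgEquiv β.symm)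
      β.symm_apply_apply
  have h1 := hθ' n ((ofStarAlgEquiv β).mapMatrix (Fin n) (CStarMatrix.ofMatrix M))
  have h2 := hθ' n (CStarMatrix.ofMatrix M)
  exact h1.trans ((hβ n _).trans h2.symm)

theorem arisesFromDynamicalSystem_of_hasPolarFactorization {P : A →CP A}
    (hP : HasPolarFactorization P) : ArisesFromDynamicalSystem P := by
  obtain ⟨E, α, hE, hidem, hα, hsurj, hPα⟩ := hP
  have h : E.IsContractiveProjection := ⟨hE, hidem⟩
  -- α is only known to be linear. Since P agrees with α on E(A), writing it through P exhibits it
  -- as completely positive.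
  let φ : ChoiEffros E h →CP ChoiEffros E h :=
    (ChoiEffros.projection E h).comp (P.comp (ChoiEffros.inclusion E h))
  have hval : ∀ x : E.range, (x : A) = ChoiEffros.val E h x := fun _ => rfl
  have hPval : ∀ x : ChoiEffros E h, P (ChoiEffros.val E h x) = (α x : A) := fun x => by
    rw [hPα]
    congr 2
    exact Subtype.ext (ChoiEffros.apply_val x)
  have hφα : ∀ x, φ x = α x := fun x =>
    ChoiEffros.val_injective ((congrArg E (hPval x)).trans (ChoiEffros.apply_val (α x)))
  have hφ : φ.IsCompleteIsometry := by
    intro n M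
    rw [← ChoiEffros.norm_map_val, ← ChoiEffros.norm_map_val]
    refine Eq.trans ?_ (hα n fun i j => M i j)
    congr 1
    ext i j
    exact congrArg (ChoiEffros.val E h) (hφα (M i j))
  have hφs : Function.Surjective φ := fun y => by
    obtain ⟨x, hx⟩ := hsurj y
    exact ⟨x, (hφα x).trans hx⟩
  obtain ⟨β, hβ⟩ := hφ.exists_starAlgEquiv hφs
  refine ⟨ChoiEffros E h, inferInstance, inferInstance, inferInstance, β,
    ChoiEffros.projection E h, ChoiEffros.inclusion E h, ChoiEffros.isContraction_projection,
    ChoiEffros.isContraction_inclusion, ChoiEffros.proj_val, fun a => ?_⟩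
  rw [hβ, hφα, hPα]
  rfl

theorem hasPolarFactorization_of_arisesFromDynamicalSystem {P : A →CP A}
    (hP : ArisesFromDynamicalSystem P) : HasPolarFactorization P := by
  obtain ⟨B, _, _, _, β, θ, θ', hθ, hθ', hid, hPθ⟩ := hP
  have hiso := hθ'.isCompleteIsometry hθ hid
  let E : A →CP A := θ'.comp θ
  have hE : ∀ a, E a = θ' (θ a) := fun _ => rfl
  have hidem : ∀ a, E (E a) = E a := fun a => by rw [hE, hE, hid]
  have hPE : ∀ a, P a ∈ E.range := fun a => by
    rw [mem_range_iff_of_idem hidem, hPθ, hE, hid]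
  have hα : ∀ x : E.range, θ' (θ x) = x := fun x => (mem_range_iff_of_idem hidem).1 x.2
  refine ⟨E, (P.toLinearMap ∘ₗ E.range.subtype).codRestrict E.range fun x => hPE x, hθ'.comp hθ,
    hidem, ?_, ?_, ?_⟩
  · intro n x
    have h1 := norm_map_conjugate_starAlgEquiv hiso β fun i j => θ (x i j)
    simp only [hα] at h1
    refine Eq.trans ?_ h1
    congr 1
    ext i j
    exact hPθ _
  · intro y
    refine ⟨⟨θ' (β.symm (θ y)), θ' (β.symm (θ y)), (hE _).trans (by rw [hid])⟩,
      Subtype.ext ?_⟩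
    have hy : P (θ' (β.symm (θ y))) = y := by
      rw [hPθ, hid, StarAlgEquiv.apply_symm_apply, hα]
    exact hy
  · intro a
    refine Eq.trans ?_ (hPθ (E a)).symm
    rw [hPθ, hE, hid]

theorem restrictRange_of_arisesFromDynamicalSystem {P : A →CP A}
    (hP : ArisesFromDynamicalSystem P) :
    IsCompletelyIsometric P.restrictRange ∧ Function.Surjective P.restrictRange := by
  obtain ⟨B, _, _, _, β, θ, θ', hθ, hθ', hid, hPθ⟩ := hP
  have hiso := hθ'.isCompleteIsometry hθ hid
  have hα : ∀ x : P.range, θ' (θ x) = x := by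
    rintro ⟨_, a, rfl⟩
    change θ' (θ (P a)) = P a
    rw [hPθ, hid]
  constructor
  · intro n x
    have h1 := norm_map_conjugate_starAlgEquiv hiso β fun i j => θ (x i j)
    simp only [hα] at h1
    refine Eq.trans ?_ h1
    congr 1
    ext i j
    exact hPθ _
  · rintro y
    have hy : P (θ' (β.symm (θ y))) = y := by
      rw [hPθ, hid, StarAlgEquiv.apply_symm_apply, hα]
    -- The preimage must itself lie in P(A), hence the second application of β⁻¹.
    have hmem : θ' (β.symm (θ y)) = P (θ' (β.symm (β.symm (θ y)))) := by
      rw [hPθ, hid, StarAlgEquiv.apply_symm_apply]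
    exact ⟨⟨θ' (β.symm (θ y)), _, hmem.symm⟩, Subtype.ext hy⟩

end CompletelyPositiveMap

/-! ### The unital case: positivity from norms -/

/-- A self-adjoint element of a unital C⋆-algebra within distance `r` of the scalar `r` is
positive. -/
theorem CStarAlgebra.nonneg_of_norm_smul_one_sub_le {C : Type*} [CStarAlgebra C] [PartialOrder C]
    [StarOrderedRing C] {y : C} (hy : IsSelfAdjoint y) {r : ℝ} (h : ‖(r : ℂ) • (1 : C) - y‖ ≤ r) :
    0 ≤ y := by
  rw [Complex.coe_smul, ← Algebra.algebraMap_eq_smul_one] at h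
  have hs : IsSelfAdjoint (algebraMap ℝ C r - y) := (IsSelfAdjoint.algebraMap C (.all r)).sub hy
  have h1 := hs.le_algebraMap_norm_self.trans (algebraMap_mono C h)
  rwa [sub_le_self_iff] at h1

/-- A positive element `y` of a unital C⋆-algebra is within `‖y‖` of the scalar `‖y‖`. -/
theorem CStarAlgebra.norm_smul_one_sub_le {C : Type*} [CStarAlgebra C] [PartialOrder C]
    [StarOrderedRing C] {y : C} (hy : 0 ≤ y) : ‖(‖y‖ : ℂ) • (1 : C) - y‖ ≤ ‖y‖ := by
  rw [Complex.coe_smul, ← Algebra.algebraMap_eq_smul_one]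
  have h1 : 0 ≤ algebraMap ℝ C ‖y‖ - y :=
    sub_nonneg.2 (IsSelfAdjoint.of_nonneg hy).le_algebraMap_norm_self
  rw [CStarAlgebra.norm_le_iff_le_algebraMap _ (norm_nonneg _) h1]
  exact sub_le_self _ hy

namespace CompletelyPositiveMap

theorem mapMatrix_one {A : Type*} [CStarAlgebra A] [PartialOrder A] [StarOrderedRing A]
    (P : A →CP A) (h1 : P 1 = 1) {n : Type*} [Fintype n] [DecidableEq n] :
    P.mapMatrix n 1 = 1 := by
  ext i j
  by_cases h : i = j <;> simp [CStarMatrix.one_apply, h, h1]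

theorem hasPolarFactorization_of_restrictRange {A : Type*} [CStarAlgebra A] [PartialOrder A]
    [StarOrderedRing A] {P : A →CP A} (hP : P.IsContraction) (h1 : P 1 = 1)
    (hiso : IsCompletelyIsometric P.restrictRange) (hsurj : Function.Surjective P.restrictRange) :
    HasPolarFactorization P := by
  have hnorm : ∀ {n : ℕ} (M : CStarMatrix (Fin n) (Fin n) A), (∀ i j, M i j ∈ P.range) →
      ‖P.mapMatrix (Fin n) M‖ = ‖M‖ := fun {n} M hM => hiso n fun i j => ⟨M i j, hM i j⟩
  have hnorm1 : ∀ {x : A}, x ∈ P.range → ‖P x‖ = ‖x‖ := fun {x} hx => by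
    have h := hnorm (CStarMatrix.scalarHom x : CStarMatrix (Fin 1) (Fin 1) A)
      fun i j => by simpa [CStarMatrix.scalarHom, Subsingleton.elim i j] using hx
    rwa [mapMatrix_scalarHom, CStarMatrix.norm_scalarHom, CStarMatrix.norm_scalarHom] at h
  have hinj : Function.Injective P.restrictRange := by
    refine (injective_iff_map_eq_zero P.restrictRange).2 fun x hx => Subtype.ext ?_
    have hx0 : P (x : A) = 0 := congrArg Subtype.val hx
    exact norm_eq_zero.1 ((hnorm1 x.2).symm.trans (by rw [hx0, norm_zero]))
  let α : P.range ≃ₗ[ℂ] P.range := LinearEquiv.ofBijective P.restrictRange ⟨hinj, hsurj⟩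
  -- E₀ a is the unique element of P(A) with the same image under P as a.
  let E₀ : A →ₗ[ℂ] A := P.range.subtype ∘ₗ α.symm.toLinearMap ∘ₗ P.toLinearMap.rangeRestrict
  have hPE : ∀ a, P (E₀ a) = P a := fun a =>
    congrArg Subtype.val (α.apply_symm_apply (P.toLinearMap.rangeRestrict a))
  have hmem : ∀ a, E₀ a ∈ P.range := fun a => Subtype.property _
  have huniq : ∀ {x y : A}, x ∈ P.range → y ∈ P.range → P x = P y → x = y := fun hx hy hxy =>
    congrArg Subtype.val (@hinj ⟨_, hx⟩ ⟨_, hy⟩ (Subtype.ext hxy))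
  have hfix : ∀ {x : A}, x ∈ P.range → E₀ x = x := fun hx => huniq (hmem _) hx (hPE _)
  have hstar : ∀ {x : A}, x ∈ P.range → star x ∈ P.range := by
    rintro _ ⟨a, rfl⟩
    exact ⟨star a, map_star P a⟩
  have hone : (1 : A) ∈ P.range := ⟨1, h1⟩
  have hEstar : ∀ a, E₀ (star a) = star (E₀ a) := fun a =>
    huniq (hmem _) (hstar (hmem a)) (by rw [hPE, map_star, map_star, hPE])
  let E : A →CP A :=
    { toLinearMap := E₀
      map_cstarMatrix_nonneg' := by
        intro k M hM
        have hY : 0 ≤ M.map P := P.map_cstarMatrix_nonneg M hM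
        have hsa : IsSelfAdjoint (M.map E₀) := by
          have hMs := (IsSelfAdjoint.of_nonneg hM).star_eq
          ext i j
          rw [CStarMatrix.star_apply, CStarMatrix.map_apply, CStarMatrix.map_apply, ← hEstar,
            ← CStarMatrix.star_apply, hMs]
        -- With r = ‖P(M)‖, the matrix r·1 - E₀(M) has entries in P(A), so its norm equals that of
        -- its image r·1 - P(M), which is at most r because P(M) ≥ 0.
        refine CStarAlgebra.nonneg_of_norm_smul_one_sub_le hsa (r := ‖M.map P‖) ?_
        rw [← hnorm]
        · rw [map_sub, map_smul, mapMatrix_one _ h1]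
          have hPM : P.mapMatrix (Fin k) (M.map E₀) = M.map P := by
            ext i j
            exact hPE (M i j)
          rw [hPM]
          exact CStarAlgebra.norm_smul_one_sub_le hY
        · intro i j
          refine P.range.sub_mem (P.range.smul_mem _ ?_) (hmem _)
          rw [CStarMatrix.one_apply]
          split_ifs
          exacts [hone, P.range.zero_mem] }
  have hE : ∀ a, E a = E₀ a := fun _ => rfl
  have hrange : E.range = P.range := by
    ext x
    exact ⟨fun ⟨a, ha⟩ => ha ▸ hmem a, fun hx => ⟨x, hfix hx⟩⟩
  have hEmem : ∀ {x : A}, x ∈ E.range → x ∈ P.range := fun hx => hrange ▸ hx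
  refine ⟨E, (P.toLinearMap ∘ₗ E.range.subtype).codRestrict E.range fun x => ?_,
    fun a => ?_, fun a => hfix (hmem a), ?_, ?_, fun a => (hPE a).symm⟩
  · exact hrange.symm.le (⟨x, rfl⟩ : P x ∈ P.range)
  · rw [hE, ← hnorm1 (hmem a), hPE]
    exact hP a
  · exact fun n x => hnorm (CStarMatrix.ofMatrix fun i j => (x i j : A)) fun i j => hEmem (x i j).2
  · rintro ⟨y, hy⟩
    obtain ⟨⟨x, hx⟩, hxy⟩ := hsurj ⟨y, hEmem hy⟩
    have hPx : P x = y := congrArg Subtype.val hxy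
    exact ⟨⟨x, hrange.symm.le hx⟩, Subtype.ext hPx⟩

end CompletelyPositiveMap

theorem proposition3p2 :
    (∀ (A : Type*) [NonUnitalCStarAlgebra A] [PartialOrder A] [StarOrderedRing A] (P : A →CP A),
      P.IsContraction →
        (HasPolarFactorization P ↔ ArisesFromDynamicalSystem P)) ∧
    (∀ (A : Type*) [CStarAlgebra A] [PartialOrder A] [StarOrderedRing A] (P : A →CP A),
      P.IsContraction → P 1 = 1 →
        ((IsCompletelyIsometric P.restrictRange ∧ Function.Surjective P.restrictRange) ↔
          ArisesFromDynamicalSystem P)) := by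
  refine ⟨fun A _ _ _ P _ =>
    ⟨CompletelyPositiveMap.arisesFromDynamicalSystem_of_hasPolarFactorization,
      CompletelyPositiveMap.hasPolarFactorization_of_arisesFromDynamicalSystem⟩,
    fun A _ _ _ P hP h1 => ⟨fun ⟨hiso, hsurj⟩ => ?_,
      CompletelyPositiveMap.restrictRange_of_arisesFromDynamicalSystem⟩⟩
  exact CompletelyPositiveMap.arisesFromDynamicalSystem_of_hasPolarFactorization
    (CompletelyPositiveMap.hasPolarFactorization_of_restrictRange hP h1 hiso hsurj)
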